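/- For $p\in[0,1]$, a generalised Bernoulli random variable with parameter $p$ takes the value $1-p$ with probability $p$ and the value $-p$ with probability $1-p$. Let $\mathrm{PoiBin}_2(p_1,p_2)$ be the law of $X_1+X_2$, where $X_1,X_2$ are independent generalised Bernoulli random variables with parameters $p_1,p_2\in[0,1]$. For $t\neq 0$ put $$g_{p_1,p_2}(t)=\sum_{i=1}^{2}\frac1{t^2}\log\left[p_i e^{t(1-p_i)}+(1-p_i)e^{-tp_i}\right],\qquad t^*_{p_1,p_2}=\log\left[\frac{1-p_1}{p_1}\cdot\frac{1-p_2}{p_2}\right],$$ where $t^*_{p_1,p_2}=+\infty$ if $p_1+p_2<1$ and some $p_i=0$, and $t^*_{p_1,p_2}=-\infty$ if $p_1+p_2>1$ and some $p_i=1$. Let $C\subset[0,1]^2$ be the set of all $(p_1,p_2)\in[0,1]^2$ such that - if $p_1+p_2<1$, then $g_{p_1,p_2}'(t)>0$ for all $0<t<t^*_{p_1,p_2}$; - if $p_1+p_2>1$, then $g_{p_1,p_2}'(t)<0$ for all $t^*_{p_1,p_2}<t<0$; - if $p_1+p_2=1$, then $2p_1p_2-p_1(2p_1-1)-p_2(2p_2-1)\ge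 0$. Then for every $(p_1,p_2)\in C$ and every random variable $X\sim\mathrm{PoiBin}_2(p_1,p_2)$, $$\mathbb E\,e^{tX}\le\exp\left[\frac{1-p_1-p_2}{\log\left[\frac{1-p_1}{p_1}\cdot\frac{1-p_2}{p_2}\right]}\,t^2\right]\quad\text{for all }t\in\mathbb R,$$ where for $p_1+p_2=1$ the quotient, which then reads $0/0$, stands for its limit $p_1(1-p_1)$. -/

import Mathlib

open MeasureTheory ProbabilityTheory

noncomputable section

namespace KearnsSaul

/-- The generalised (centred) Bernoulli law with parameter `p ∈ [0,1]`:
mass `p` at `1 - p` and mass `1 - p` at `-p`. -/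
def genBernoulli (p : ℝ) : Measure ℝ :=
  ENNReal.ofReal p • Measure.dirac (1 - p) + ENNReal.ofReal (1 - p) • Measure.dirac (-p)

/-- The generalised Poisson-binomial law: the law of `X₁ + ⋯ + Xₙ` for independent
generalised Bernoulli variables `Xᵢ` with parameters `p i`. -/
def poiBin {n : ℕ} (p : Fin n → ℝ) : Measure ℝ :=
  (Measure.pi fun i => genBernoulli (p i)).map fun x => ∑ i, x i

/-- The function `g_p`; only its values at `t ≠ 0` are used. -/
def gOne (p t : ℝ) : ℝ :=
  1 / t ^ 2 * Real.log (p * Real.exp (t * (1 - p)) + (1 - p) * Real.exp (-t * p))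

/-- The function `g_{p₁,p₂} = g_{p₁} + g_{p₂}`; only its values at `t ≠ 0` are used. -/
def gTwo (p₁ p₂ t : ℝ) : ℝ := gOne p₁ t + gOne p₂ t

/-- `t* = log [(1-p₁)/p₁ · (1-p₂)/p₂]`, as an extended real number, so that it is `+∞` if some
`pᵢ` is `0` (and `p₁ + p₂ < 1`) and `-∞` if some `pᵢ` is `1` (and `p₁ + p₂ > 1`). -/
def tStar (p₁ p₂ : ℝ) : EReal :=
  ENNReal.log (ENNReal.ofReal (1 - p₁) / ENNReal.ofReal p₁ *
    (ENNReal.ofReal (1 - p₂) / ENNReal.ofReal p₂))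

/-- The set `C`: those parameters in the unit square for which `g_{p₁,p₂}` is strictly monotone
between `0` and `t*` in the direction of `t*`, in the sense of a strict sign of its derivative.
On the line `p₁ + p₂ = 1` there is nothing between `0` and `t* = 0`, and the condition is
the inequality `2 p₁ p₂ - p₁ (2 p₁ - 1) - p₂ (2 p₂ - 1) ≥ 0`,
that is `(3 - √3)/6 ≤ p₁ ≤ (3 + √3)/6`. -/
def C : Set (ℝ × ℝ) :=
  {p | p.1 ∈ Set.Icc (0 : ℝ) 1 ∧ p.2 ∈ Set.Icc (0 : ℝ) 1 ∧
    (p.1 + p.2 < 1 →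
      ∀ t : ℝ, 0 < t → (t : EReal) < tStar p.1 p.2 → 0 < deriv (gTwo p.1 p.2) t) ∧
    (1 < p.1 + p.2 →
      ∀ t : ℝ, t < 0 → tStar p.1 p.2 < (t : EReal) → deriv (gTwo p.1 p.2) t < 0) ∧
    (p.1 + p.2 = 1 →
      0 ≤ 2 * p.1 * p.2 - p.1 * (2 * p.1 - 1) - p.2 * (2 * p.2 - 1))}

/-- The coefficient `(1-p₁-p₂) / log [(1-p₁)/p₁ · (1-p₂)/p₂]`. On the line `p₁ + p₂ = 1`, where
this reads `0/0`, it is given its limit `p₁ (1 - p₁)`. -/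
def coeff (p₁ p₂ : ℝ) : ℝ :=
  if p₁ + p₂ = 1 then p₁ * (1 - p₁)
  else (1 - p₁ - p₂) / Real.log ((1 - p₁) / p₁ * ((1 - p₂) / p₂))

end KearnsSaul

end

/-! Let `p₁ + p₂ < 1` with both parameters positive, and put `u₀ = t*/2`, `t = u + u₀`. Up to the
factor `exp (t (1 - p₁ - p₂))`, the product of the two moment generating functions is `a cosh u +
b`, even in `u` (`bernoulliMGF_mul_bernoulliMGF`). The claim becomes that `H u = c u² - log (a cosh
u + b)` is minimal at `±u₀`, that is, at `t = t*` and `t = 0`. Membership in `C` gives this for `|u|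
< u₀`, because `g` increases up to `g(t*) = c`. Outside, the sign of `H''` is that of a convex
quadratic in `cosh u`, which rules out a further descent (`log_cosh_le_of_lt_inside`).

A zero parameter is incompatible with `C` when `p₁ + p₂ < 1` (`not_forall_deriv_gTwo_pos`). The case
`p₁ + p₂ > 1` follows by `p ↦ 1 - p`, `t ↦ -t`. On `p₁ + p₂ = 1` power series are compared termwise
(`one_add_mul_cosh_sub_one_le_exp`). -/

namespace KearnsSaul

/-- The moment generating function of the generalised Bernoulli law. -/
noncomputable def bernoulliMGF (p t : ℝ) : ℝ :=
  p * Real.exp (t * (1 - p)) + (1 - p) * Real.exp (-t * p)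

lemma one_le_bernoulliMGF {p : ℝ} (h0 : 0 ≤ p) (h1 : p ≤ 1) (t : ℝ) : 1 ≤ bernoulliMGF p t := by
  have e1 := mul_le_mul_of_nonneg_left (Real.add_one_le_exp (t * (1 - p))) h0
  have e2 := mul_le_mul_of_nonneg_left (Real.add_one_le_exp (-t * p)) (sub_nonneg.2 h1)
  unfold bernoulliMGF
  nlinarith

lemma bernoulliMGF_le_exp {p : ℝ} (h0 : 0 ≤ p) (h1 : p ≤ 1) {t : ℝ} (ht : 0 ≤ t) :
    bernoulliMGF p t ≤ Real.exp t := by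
  have e1 : Real.exp (t * (1 - p)) ≤ Real.exp t := Real.exp_le_exp.2 (by nlinarith)
  have e2 : Real.exp (-t * p) ≤ Real.exp t := Real.exp_le_exp.2 (by nlinarith)
  have e3 := mul_le_mul_of_nonneg_left e1 h0
  have e4 := mul_le_mul_of_nonneg_left e2 (sub_nonneg.2 h1)
  unfold bernoulliMGF
  linarith

lemma bernoulliMGF_one_sub (p t : ℝ) : bernoulliMGF (1 - p) t = bernoulliMGF p (-t) := by
  unfold bernoulliMGF
  rw [show t * (1 - (1 - p)) = - -t * p by ring]
  ring

lemma continuous_bernoulliMGF (p : ℝ) : Continuous (bernoulliMGF p) := by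
  unfold bernoulliMGF
  fun_prop

lemma gTwo_eq (p₁ p₂ t : ℝ) :
    gTwo p₁ p₂ t =
      1 / t ^ 2 * (Real.log (bernoulliMGF p₁ t) + Real.log (bernoulliMGF p₂ t)) := by
  unfold gTwo gOne bernoulliMGF
  ring

lemma gTwo_one_sub (p₁ p₂ t : ℝ) : gTwo (1 - p₁) (1 - p₂) t = gTwo p₁ p₂ (-t) := by
  rw [gTwo_eq, gTwo_eq, bernoulliMGF_one_sub, bernoulliMGF_one_sub, neg_sq]

lemma deriv_gTwo_one_sub (p₁ p₂ t : ℝ) :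
    deriv (gTwo (1 - p₁) (1 - p₂)) t = -deriv (gTwo p₁ p₂) (-t) := by
  rw [funext (gTwo_one_sub p₁ p₂)]
  exact deriv_comp_neg _ _

/-! ### Exponential moments of the laws -/

section GenBernoulli

lemma isProbabilityMeasure_genBernoulli {p : ℝ} (h0 : 0 ≤ p) (h1 : p ≤ 1) :
    IsProbabilityMeasure (genBernoulli p) := by
  constructor
  simp only [genBernoulli, Measure.coe_add, Measure.coe_smul, Pi.add_apply, Pi.smul_apply,
    measure_univ, smul_eq_mul, mul_one]
  rw [← ENNReal.ofReal_add h0 (sub_nonneg.2 h1)]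
  simp

lemma integrable_genBernoulli (p : ℝ) (f : ℝ → ℝ) : Integrable f (genBernoulli p) := by
  unfold genBernoulli
  exact ((integrable_dirac (by simp)).smul_measure ENNReal.ofReal_ne_top).add_measure
    ((integrable_dirac (by simp)).smul_measure ENNReal.ofReal_ne_top)

lemma integral_exp_genBernoulli {p : ℝ} (h0 : 0 ≤ p) (h1 : p ≤ 1) (t : ℝ) :
    ∫ x, Real.exp (t * x) ∂genBernoulli p = bernoulliMGF p t := by
  unfold genBernoulli
  rw [integral_add_measure
    ((integrable_dirac (by simp)).smul_measure ENNReal.ofReal_ne_top)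
    ((integrable_dirac (by simp)).smul_measure ENNReal.ofReal_ne_top),
    integral_smul_measure, integral_smul_measure, integral_dirac, integral_dirac,
    ENNReal.toReal_ofReal h0, ENNReal.toReal_ofReal (sub_nonneg.2 h1)]
  simp [bernoulliMGF]

variable {n : ℕ} {p : Fin n → ℝ}

lemma exp_mul_sum_eq_prod (t : ℝ) (x : Fin n → ℝ) :
    Real.exp (t * ∑ i, x i) = ∏ i, Real.exp (t * x i) := by
  rw [Finset.mul_sum, Real.exp_sum]

lemma integrable_exp_poiBin (hp : ∀ i, p i ∈ Set.Icc (0 : ℝ) 1) (t : ℝ) :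
    Integrable (fun x => Real.exp (t * x)) (poiBin p) := by
  have := fun i => isProbabilityMeasure_genBernoulli (hp i).1 (hp i).2
  unfold poiBin
  rw [integrable_map_measure (by fun_prop) (by fun_prop)]
  simp only [Function.comp_def, exp_mul_sum_eq_prod]
  exact Integrable.fintype_prod (f := fun _ x => Real.exp (t * x))
    fun i => integrable_genBernoulli _ _

lemma integral_exp_poiBin (hp : ∀ i, p i ∈ Set.Icc (0 : ℝ) 1) (t : ℝ) :
    ∫ x, Real.exp (t * x) ∂poiBin p = ∏ i, bernoulliMGF (p i) t := by
  have := fun i => isProbabilityMeasure_genBernoulli (hp i).1 (hp i).2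
  unfold poiBin
  rw [integral_map (by fun_prop) (by fun_prop)]
  simp only [exp_mul_sum_eq_prod]
  rw [integral_fintype_prod_eq_prod (f := fun _ x => Real.exp (t * x))]
  exact Finset.prod_congr rfl fun i _ => integral_exp_genBernoulli (hp i).1 (hp i).2 t

end GenBernoulli

/-! ### Global minimum at half of `t*` -/

/-- The derivative of a difference of a quadratic and a `log (a * cosh + b)` has no more sign
changes than a convex quadratic in `cosh`; hence a strict minimum over `[-u₀, u₀]` that is attained
at the critical point `u₀` is global. -/
lemma log_cosh_le_of_lt_inside {a b c u₀ : ℝ} (ha : 0 < a) (hb : 0 ≤ b) (hc : 0 ≤ c) (hu₀ : 0 < u₀)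
    (hcrit : 2 * c * u₀ * (a * Real.cosh u₀ + b) = a * Real.sinh u₀)
    (hin : ∀ u, -u₀ < u → u < u₀ → c * u₀ ^ 2 - Real.log (a * Real.cosh u₀ + b) <
      c * u ^ 2 - Real.log (a * Real.cosh u + b)) (u : ℝ) :
    c * u₀ ^ 2 - Real.log (a * Real.cosh u₀ + b) ≤
      c * u ^ 2 - Real.log (a * Real.cosh u + b) := by
  have hpos : ∀ x, 0 < a * Real.cosh x + b := fun x => by
    have := mul_pos ha (Real.cosh_pos x)
    linarith
  set H : ℝ → ℝ := fun x => c * x ^ 2 - Real.log (a * Real.cosh x + b) with hH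
  set H' : ℝ → ℝ := fun x => 2 * c * x - a * Real.sinh x / (a * Real.cosh x + b) with hH'
  set H'' : ℝ → ℝ := fun x => 2 * c - (a * Real.cosh x * (a * Real.cosh x + b) -
    a * Real.sinh x * (a * Real.sinh x)) / (a * Real.cosh x + b) ^ 2 with hH''
  have hden : ∀ x, HasDerivAt (fun x => a * Real.cosh x + b) (a * Real.sinh x) x := fun x =>
    ((Real.hasDerivAt_cosh x).const_mul a).add_const b
  have hd : ∀ x, HasDerivAt H (H' x) x := fun x =>
    (((hasDerivAt_pow 2 x).const_mul c).sub ((hden x).log (hpos x).ne')).congr_deriv (by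
      simp only [hH']
      norm_num
      ring)
  have hdd : ∀ x, HasDerivAt H' (H'' x) x := fun x =>
    (((hasDerivAt_id x).const_mul (2 * c)).sub
      (((Real.hasDerivAt_sinh x).const_mul a).div (hden x) (hpos x).ne')).congr_deriv (by
        simp only [hH'', mul_one])
  have hsign : ∀ x, H'' x * (a * Real.cosh x + b) ^ 2 =
      2 * c * (a * Real.cosh x + b) ^ 2 - a ^ 2 - a * b * Real.cosh x := fun x => by
    have h := (hpos x).ne'
    simp only [hH'']
    field_simp
    linear_combination (-a ^ 2) * Real.cosh_sq x
  have hcont : Continuous H := continuous_iff_continuousAt.2 fun x => (hd x).continuousAt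
  have hcont' : Continuous H' := continuous_iff_continuousAt.2 fun x => (hdd x).continuousAt
  have hH'0 : H' 0 = 0 := by simp [hH']
  have hH'u₀ : H' u₀ = 0 := by
    have h := (hpos u₀).ne'
    simp only [hH']
    field_simp
    linarith
  -- A value below `H u₀` beyond `u₀` would, by the mean value theorem and `H' 0 = H' u₀ = 0`, give
  -- `H''` the signs `-, +, -` at points `z₁ < z₂ < w`.
  have hright : ∀ v, u₀ < v → H u₀ ≤ H v := by
    intro v hv
    by_contra! hlt
    obtain ⟨w₁, ⟨hw₁, -⟩, hw₁'⟩ := exists_hasDerivAt_eq_slope H H' hv hcont.continuousOn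
      fun x _ => hd x
    have hw₁neg : H' w₁ < 0 := by
      rw [hw₁']
      exact div_neg_of_neg_of_pos (by linarith) (by linarith)
    obtain ⟨w, ⟨hw, -⟩, hw'⟩ := exists_hasDerivAt_eq_slope H' H'' hw₁ hcont'.continuousOn
      fun x _ => hdd x
    have hwneg : H'' w < 0 := by
      rw [hw', hH'u₀]
      exact div_neg_of_neg_of_pos (by linarith) (by linarith)
    obtain ⟨z, ⟨hz0, hzu⟩, hz'⟩ := exists_hasDerivAt_eq_slope H H' hu₀ hcont.continuousOn
      fun x _ => hd x
    have hzneg : H' z < 0 := by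
      rw [hz']
      have : H u₀ < H 0 := hin 0 (by linarith) hu₀
      exact div_neg_of_neg_of_pos (by linarith) (by linarith)
    obtain ⟨z₁, ⟨hz₁0, hz₁z⟩, hz₁'⟩ := exists_hasDerivAt_eq_slope H' H'' hz0 hcont'.continuousOn
      fun x _ => hdd x
    have hz₁neg : H'' z₁ < 0 := by
      rw [hz₁', hH'0]
      exact div_neg_of_neg_of_pos (by linarith) (by linarith)
    obtain ⟨z₂, ⟨hz₂z, hz₂u⟩, hz₂'⟩ := exists_hasDerivAt_eq_slope H' H'' hzu hcont'.continuousOn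
      fun x _ => hdd x
    have hz₂pos : 0 < H'' z₂ := by
      rw [hz₂', hH'u₀]
      exact div_pos (by linarith) (by linarith)
    have q₁ := mul_neg_of_neg_of_pos hz₁neg (pow_pos (hpos z₁) 2)
    have q₂ := mul_pos hz₂pos (pow_pos (hpos z₂) 2)
    have q₃ := mul_neg_of_neg_of_pos hwneg (pow_pos (hpos w) 2)
    rw [hsign] at q₁ q₂ q₃
    have c₁ : Real.cosh z₁ < Real.cosh z₂ := Real.cosh_lt_cosh.2 (by
      rw [abs_of_pos hz₁0, abs_of_pos (by linarith)]; linarith)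
    have c₂ : Real.cosh z₂ < Real.cosh w := Real.cosh_lt_cosh.2 (by
      rw [abs_of_pos (by linarith), abs_of_pos (by linarith)]; linarith)
    generalize Real.cosh z₁ = A at *
    generalize Real.cosh z₂ = B at *
    generalize Real.cosh w = D at *
    -- Second divided difference at `A < B < D` of the quadratic in `cosh`, whose leading
    -- coefficient `2 c a²` is nonnegative.
    have r₁ := mul_neg_of_neg_of_pos q₁ (sub_pos.2 c₂)
    have r₃ := mul_neg_of_neg_of_pos q₃ (sub_pos.2 c₁)
    have r₂ := mul_pos q₂ (sub_pos.2 (c₁.trans c₂))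
    have : 0 ≤ 2 * c * a ^ 2 * ((B - A) * (D - B) * (D - A)) := by
      have h₁ := sub_pos.2 c₁
      have h₂ := sub_pos.2 c₂
      have h₃ := sub_pos.2 (c₁.trans c₂)
      positivity
    nlinarith
  rcases lt_trichotomy u₀ |u| with h | h | h
  · have := hright _ h
    simpa [hH] using this
  · rw [h]
    simp
  · exact (hin u (by linarith [neg_abs_le u]) (by linarith [le_abs_self u])).le

/-- The product of two moment generating functions, centred at half of `t*`. -/
lemma bernoulliMGF_mul_bernoulliMGF {p₁ p₂ r u₀ : ℝ} (hp : p₁ * p₂ = r * Real.exp (-u₀))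
    (hq : (1 - p₁) * (1 - p₂) = r * Real.exp u₀) (u : ℝ) :
    bernoulliMGF p₁ (u + u₀) * bernoulliMGF p₂ (u + u₀) =
      Real.exp ((u + u₀) * (1 - p₁ - p₂)) *
        (2 * r * Real.cosh u + (p₁ * (1 - p₂) + p₂ * (1 - p₁))) := by
  set t := u + u₀ with ht
  have e : ∀ p, bernoulliMGF p t = Real.exp (-t * p) * (p * Real.exp t + (1 - p)) := fun p => by
    rw [bernoulliMGF, show t * (1 - p) = -t * p + t by ring, Real.exp_add]
    ring
  have hcosh : 2 * r * Real.cosh u * Real.exp t =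
      p₁ * p₂ * Real.exp t ^ 2 + (1 - p₁) * (1 - p₂) := by
    rw [hp, hq, Real.cosh_eq, ht, Real.exp_add, Real.exp_neg, Real.exp_neg]
    field_simp
  have e' : Real.exp (-t * p₁) * Real.exp (-t * p₂) * Real.exp t =
      Real.exp (t * (1 - p₁ - p₂)) := by
    rw [← Real.exp_add, ← Real.exp_add]
    congr 1
    ring
  rw [e, e, ← e']
  linear_combination (-(Real.exp (-t * p₁) * Real.exp (-t * p₂))) * hcosh

/-! ### The case `p₁ + p₂ < 1` -/

lemma continuousOn_gTwo {p₁ p₂ : ℝ} (h₁ : p₁ ∈ Set.Icc (0 : ℝ) 1) (h₂ : p₂ ∈ Set.Icc (0 : ℝ) 1) :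
    ContinuousOn (gTwo p₁ p₂) (Set.Ioi 0) := by
  rw [funext (gTwo_eq p₁ p₂)]
  have l : ∀ p ∈ Set.Icc (0 : ℝ) 1, Continuous fun t => Real.log (bernoulliMGF p t) := fun p hp =>
    (continuous_bernoulliMGF p).log fun t =>
      (zero_lt_one.trans_le (one_le_bernoulliMGF hp.1 hp.2 t)).ne'
  refine ContinuousOn.mul (continuousOn_const.div (by fun_prop) fun t ht => ?_)
    ((l _ h₁).add (l _ h₂)).continuousOn
  exact pow_ne_zero 2 (ne_of_gt ht)

/-- Each log-MGF lies between `0` and `t`, so `0 ≤ g(t) ≤ 2/t`: a nonnegative function tending to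
`0` cannot increase strictly on the whole half-line. -/
lemma not_forall_deriv_gTwo_pos {p₁ p₂ : ℝ} (h₁ : p₁ ∈ Set.Icc (0 : ℝ) 1)
    (h₂ : p₂ ∈ Set.Icc (0 : ℝ) 1) : ¬ ∀ t, 0 < t → 0 < deriv (gTwo p₁ p₂) t := by
  intro h
  have mono : StrictMonoOn (gTwo p₁ p₂) (Set.Ioi 0) :=
    strictMonoOn_of_deriv_pos (convex_Ioi 0) (continuousOn_gTwo h₁ h₂) (by simpa using h)
  have hnonneg : 0 ≤ gTwo p₁ p₂ 1 := by
    rw [gTwo_eq]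
    have := Real.log_nonneg (one_le_bernoulliMGF h₁.1 h₁.2 1)
    have := Real.log_nonneg (one_le_bernoulliMGF h₂.1 h₂.2 1)
    positivity
  have hpos : 0 < gTwo p₁ p₂ 2 :=
    hnonneg.trans_lt (mono (by simp) (by simp) (by norm_num))
  set ε := gTwo p₁ p₂ 2
  -- Large enough that `ε t > 2`, against `ε < g(t) ≤ 2/t`.
  set t : ℝ := 2 + 2 / ε with ht
  have ht2 : 2 < t := by
    have : 0 < 2 / ε := by positivity
    linarith
  have hlt : ε < gTwo p₁ p₂ t := mono (by simp) (by simp; linarith) ht2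
  have hlog : ∀ p ∈ Set.Icc (0 : ℝ) 1, Real.log (bernoulliMGF p t) ≤ t := fun p hp => by
    rw [Real.log_le_iff_le_exp (zero_lt_one.trans_le (one_le_bernoulliMGF hp.1 hp.2 t))]
    exact bernoulliMGF_le_exp hp.1 hp.2 (by linarith)
  rw [gTwo_eq, one_div_mul_eq_div, lt_div_iff₀ (by positivity)] at hlt
  have e : ε * t = 2 * ε + 2 := by
    rw [ht]
    field_simp
  nlinarith [hlog _ h₁, hlog _ h₂]

lemma tStar_eq {p₁ p₂ : ℝ} (h₁ : p₁ ∈ Set.Ioo (0 : ℝ) 1) (h₂ : p₂ ∈ Set.Ioo (0 : ℝ) 1) :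
    tStar p₁ p₂ = (Real.log ((1 - p₁) / p₁ * ((1 - p₂) / p₂)) : ℝ) := by
  have k₁ := div_pos (sub_pos.2 h₁.2) h₁.1
  have k₂ := div_pos (sub_pos.2 h₂.2) h₂.1
  rw [tStar, ← ENNReal.ofReal_div_of_pos h₁.1, ← ENNReal.ofReal_div_of_pos h₂.1,
    ← ENNReal.ofReal_mul k₁.le, ENNReal.log_ofReal_of_pos (mul_pos k₁ k₂)]

lemma bernoulliMGF_mul_le_of_interior {p₁ p₂ : ℝ} (h₁ : p₁ ∈ Set.Ioo (0 : ℝ) 1)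
    (h₂ : p₂ ∈ Set.Ioo (0 : ℝ) 1) (hlt : p₁ + p₂ < 1)
    (hderiv : ∀ t, 0 < t → t < Real.log ((1 - p₁) / p₁ * ((1 - p₂) / p₂)) →
      0 < deriv (gTwo p₁ p₂) t) (t : ℝ) :
    bernoulliMGF p₁ t * bernoulliMGF p₂ t ≤
      Real.exp ((1 - p₁ - p₂) / Real.log ((1 - p₁) / p₁ * ((1 - p₂) / p₂)) * t ^ 2) := by
  have k₁ := sub_pos.2 h₁.2
  have k₂ := sub_pos.2 h₂.2
  obtain ⟨h₁0, h₁1⟩ := h₁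
  obtain ⟨h₂0, h₂1⟩ := h₂
  have hratio : (1 - p₁) / p₁ * ((1 - p₂) / p₂) = (1 - p₁) * (1 - p₂) / (p₁ * p₂) := by
    field_simp
  set T := Real.log ((1 - p₁) / p₁ * ((1 - p₂) / p₂)) with hT
  have hTpos : 0 < T := by
    rw [hT, hratio]
    refine Real.log_pos ?_
    rw [one_lt_div (by positivity)]
    nlinarith
  have hexpT : Real.exp T = (1 - p₁) * (1 - p₂) / (p₁ * p₂) := by
    rw [hT, hratio, Real.exp_log (by positivity)]
  set u₀ := T / 2 with hu₀
  have hu₀pos : 0 < u₀ := by positivity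
  set c := (1 - p₁ - p₂) / T with hc
  have hcpos : 0 < c := div_pos (by linarith) hTpos
  have hcu : 2 * c * u₀ = 1 - p₁ - p₂ := by
    rw [hc, hu₀]
    field_simp
  set r := p₁ * p₂ * Real.exp u₀ with hr
  have hp : p₁ * p₂ = r * Real.exp (-u₀) := by
    rw [hr, mul_assoc, ← Real.exp_add]
    simp
  have hq : (1 - p₁) * (1 - p₂) = r * Real.exp u₀ := by
    rw [hr, mul_assoc, ← Real.exp_add, show u₀ + u₀ = T by rw [hu₀]; ring, hexpT]
    field_simp
  have hrpos : 0 < r := by positivity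
  set b := p₁ * (1 - p₂) + p₂ * (1 - p₁) with hb
  have hbpos : 0 < b := by positivity
  have hval : 2 * r * Real.cosh u₀ + b = 1 := by
    rw [Real.cosh_eq]
    linear_combination -hp - hq
  have hsinh : 2 * r * Real.sinh u₀ = 1 - p₁ - p₂ := by
    rw [Real.sinh_eq]
    linear_combination hp - hq
  have hMpos : ∀ p s, 0 < p → p < 1 → 0 < bernoulliMGF p s := fun p s h h' =>
    zero_lt_one.trans_le (one_le_bernoulliMGF h.le h'.le s)
  have hden : ∀ u, 0 < 2 * r * Real.cosh u + b := fun u => by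
    have := Real.cosh_pos u
    positivity
  have hlog : ∀ u, Real.log (bernoulliMGF p₁ (u + u₀)) + Real.log (bernoulliMGF p₂ (u + u₀)) =
      2 * c * u₀ * (u + u₀) + Real.log (2 * r * Real.cosh u + b) := fun u => by
    rw [← Real.log_mul (hMpos _ _ h₁0 h₁1).ne' (hMpos _ _ h₂0 h₂1).ne',
      bernoulliMGF_mul_bernoulliMGF hp hq, Real.log_mul (Real.exp_ne_zero _) (hden u).ne',
      Real.log_exp, hcu]
    ring
  have hmono : StrictMonoOn (gTwo p₁ p₂) (Set.Ioc 0 T) :=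
    strictMonoOn_of_deriv_pos (convex_Ioc 0 T)
      ((continuousOn_gTwo ⟨h₁0.le, h₁1.le⟩ ⟨h₂0.le, h₂1.le⟩).mono fun x hx => hx.1)
      (by
        rw [interior_Ioc]
        exact fun x hx => hderiv x hx.1 hx.2)
  have hTval : gTwo p₁ p₂ T = c := by
    rw [gTwo_eq, show T = u₀ + u₀ by rw [hu₀]; ring, hlog, hval, Real.log_one]
    field_simp
    ring
  -- For `t = u + u₀` in `(0, T)`, clearing `t²` in `g(t) < g(T) = c` and completing the square
  -- gives the strict inequality inside.
  have hmin := log_cosh_le_of_lt_inside (a := 2 * r) (b := b) (c := c) (u₀ := u₀)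
    (by positivity) hbpos.le hcpos.le hu₀pos (by rw [hval, hcu, hsinh, mul_one])
    (fun u hu hu' => by
      have hlt : gTwo p₁ p₂ (u + u₀) < c := by
        rw [← hTval]
        refine hmono ⟨by linarith, ?_⟩ ⟨hTpos, le_rfl⟩ ?_ <;> linarith
      rw [gTwo_eq, hlog, one_div_mul_eq_div, div_lt_iff₀ (pow_pos (by linarith) 2)] at hlt
      rw [hval, Real.log_one]
      linarith) (t - u₀)
  rw [hval, Real.log_one] at hmin
  have hfin := hlog (t - u₀)
  rw [sub_add_cancel] at hfin
  have hprod := mul_pos (hMpos p₁ t h₁0 h₁1) (hMpos p₂ t h₂0 h₂1)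
  rw [← Real.log_le_iff_le_exp hprod,
    Real.log_mul (hMpos _ _ h₁0 h₁1).ne' (hMpos _ _ h₂0 h₂1).ne', hfin]
  linarith

lemma bernoulliMGF_mul_le_of_add_lt_one {p₁ p₂ : ℝ} (h₁ : p₁ ∈ Set.Icc (0 : ℝ) 1)
    (h₂ : p₂ ∈ Set.Icc (0 : ℝ) 1) (hlt : p₁ + p₂ < 1)
    (hderiv : ∀ t : ℝ, 0 < t → (t : EReal) < tStar p₁ p₂ → 0 < deriv (gTwo p₁ p₂) t) (t : ℝ) :
    bernoulliMGF p₁ t * bernoulliMGF p₂ t ≤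
      Real.exp ((1 - p₁ - p₂) / Real.log ((1 - p₁) / p₁ * ((1 - p₂) / p₂)) * t ^ 2) := by
  have k₁ : p₁ < 1 := by linarith [h₂.1]
  have k₂ : p₂ < 1 := by linarith [h₁.1]
  by_cases hz : p₁ = 0 ∨ p₂ = 0
  · have htop : tStar p₁ p₂ = ⊤ := by
      have l : ∀ p : ℝ, p < 1 → ENNReal.ofReal (1 - p) / ENNReal.ofReal p ≠ 0 := fun p hp =>
        ENNReal.div_ne_zero.2 ⟨by simpa using hp, ENNReal.ofReal_ne_top⟩
      rw [tStar]
      rcases hz with rfl | rfl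
      · simp [ENNReal.top_mul (l p₂ k₂)]
      · simp [ENNReal.mul_top (l p₁ k₁)]
    refine absurd (fun s hs => hderiv s hs ?_) (not_forall_deriv_gTwo_pos h₁ h₂)
    rw [htop]
    exact EReal.coe_lt_top s
  · push Not at hz
    have i₁ : p₁ ∈ Set.Ioo (0 : ℝ) 1 := ⟨lt_of_le_of_ne h₁.1 hz.1.symm, k₁⟩
    have i₂ : p₂ ∈ Set.Ioo (0 : ℝ) 1 := ⟨lt_of_le_of_ne h₂.1 hz.2.symm, k₂⟩
    refine bernoulliMGF_mul_le_of_interior i₁ i₂ hlt (fun s hs hs' => hderiv s hs ?_) t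
    rw [tStar_eq i₁ i₂]
    exact_mod_cast hs'

/-! ### Reflection, and the line `p₁ + p₂ = 1` -/

lemma tStar_one_sub {p₁ p₂ : ℝ} (h₁ : p₁ ∈ Set.Icc (0 : ℝ) 1) (h₂ : p₂ ∈ Set.Icc (0 : ℝ) 1)
    (hgt : 1 < p₁ + p₂) : tStar (1 - p₁) (1 - p₂) = -tStar p₁ p₂ := by
  have k₁ : 0 < p₁ := by linarith [h₂.2]
  have k₂ : 0 < p₂ := by linarith [h₁.2]
  have l : ∀ p : ℝ, 0 < p →
      ENNReal.ofReal p / ENNReal.ofReal (1 - p) =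
        (ENNReal.ofReal (1 - p) / ENNReal.ofReal p)⁻¹ := fun p hp =>
    (ENNReal.inv_div (.inl ENNReal.ofReal_ne_top) (.inl (by simpa using hp))).symm
  have hfin : ∀ p : ℝ, 0 < p → ENNReal.ofReal (1 - p) / ENNReal.ofReal p ≠ ⊤ := fun p hp =>
    ENNReal.div_ne_top ENNReal.ofReal_ne_top (by simpa using hp)
  rw [tStar, tStar, sub_sub_cancel, sub_sub_cancel, l p₁ k₁, l p₂ k₂,
    ← ENNReal.mul_inv (.inr (hfin p₂ k₂)) (.inl (hfin p₁ k₁)), ENNReal.log_inv]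

/-- The symmetric law with `p₁ + p₂ = 1`, by comparison of power series. -/
lemma one_add_mul_cosh_sub_one_le_exp {a : ℝ} (ha : 1 / 6 ≤ a) (t : ℝ) :
    1 + 2 * a * (Real.cosh t - 1) ≤ Real.exp (a * t ^ 2) := by
  have hcosh := ((hasSum_nat_add_iff' 1).2 (Real.hasSum_cosh t)).mul_left (2 * a)
  have hexp := (hasSum_nat_add_iff' 1).2 (by
    simpa [Real.exp_eq_exp_ℝ] using NormedSpace.expSeries_div_hasSum_exp (a * t ^ 2) :
      HasSum (fun k : ℕ => (a * t ^ 2) ^ k / k.factorial) (Real.exp (a * t ^ 2)))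
  -- With the constant terms dropped, this compares the coefficients of `t ^ (2 * (k + 1))`.
  -- Equality at `k = 1` shows that the fourth-order term is what forces `a ≥ 1/6`.
  have hfac : ∀ k : ℕ, 2 * 6 ^ k * (k + 1).factorial ≤ (2 * (k + 1)).factorial := by
    intro k
    induction k with
    | zero => decide
    | succ k ih =>
      rw [show 2 * (k + 1 + 1) = 2 * (k + 1) + 1 + 1 by ring, Nat.factorial_succ (2 * (k + 1) + 1),
        Nat.factorial_succ (2 * (k + 1)), Nat.factorial_succ (k + 1)]
      calc 2 * 6 ^ (k + 1) * ((k + 1 + 1) * (k + 1).factorial)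
          = (2 * 6 ^ k * (k + 1).factorial) * (6 * (k + 2)) := by ring
        _ ≤ (2 * (k + 1)).factorial * (6 * (k + 2)) := Nat.mul_le_mul_right _ ih
        _ ≤ (2 * (k + 1)).factorial * ((2 * (k + 1) + 1 + 1) * (2 * (k + 1) + 1)) :=
          Nat.mul_le_mul_left _ (by nlinarith)
        _ = _ := by ring
  have hle := hasSum_le (fun k => ?_) hcosh hexp
  · simp at hle
    linarith
  · have f₁ : (0 : ℝ) < (2 * (k + 1)).factorial := by positivity
    have f₂ : (0 : ℝ) < (k + 1).factorial := by positivity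
    have f₃ : (2 * 6 ^ k * (k + 1).factorial : ℝ) ≤ (2 * (k + 1)).factorial := by
      exact_mod_cast hfac k
    have f₄ : 1 ≤ (6 * a) ^ k := one_le_pow₀ (by linarith)
    have f₅ : (2 * (k + 1).factorial : ℝ) ≤ a ^ k * (2 * (k + 1)).factorial := by
      have ha0 : 0 ≤ a := by linarith
      calc (2 * (k + 1).factorial : ℝ) ≤ (6 * a) ^ k * (2 * (k + 1).factorial) :=
            le_mul_of_one_le_left (by positivity) f₄
        _ = a ^ k * (2 * 6 ^ k * (k + 1).factorial) := by rw [mul_pow]; ring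
        _ ≤ _ := mul_le_mul_of_nonneg_left f₃ (by positivity)
    have f₆ : 0 ≤ a * t ^ (2 * (k + 1)) := by
      rw [pow_mul]
      have ha0 : 0 ≤ a := by linarith
      positivity
    rw [← mul_div_assoc, div_le_div_iff₀ f₁ f₂, mul_pow, ← pow_mul, pow_succ a]
    nlinarith [mul_le_mul_of_nonneg_left f₅ f₆]

lemma bernoulliMGF_mul_bernoulliMGF_one_sub (p t : ℝ) :
    bernoulliMGF p t * bernoulliMGF (1 - p) t = 1 + 2 * (p * (1 - p)) * (Real.cosh t - 1) := by
  have e₁ : Real.exp (t * (1 - p)) = Real.exp t * Real.exp (-(t * p)) := by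
    rw [← Real.exp_add]
    congr 1
    ring
  have e₂ : Real.exp (-t * (1 - p)) = Real.exp (-t) * Real.exp (t * p) := by
    rw [← Real.exp_add]
    congr 1
    ring
  have e₃ : Real.exp (t * p) * Real.exp (-(t * p)) = 1 := by
    rw [← Real.exp_add]
    simp
  have e₄ : Real.exp t * Real.exp (-t) = 1 := by
    rw [← Real.exp_add]
    simp
  rw [bernoulliMGF, bernoulliMGF, sub_sub_cancel, e₁, e₂, neg_mul, Real.cosh_eq]
  generalize Real.exp t = x at *
  generalize Real.exp (-t) = y at *
  generalize Real.exp (t * p) = z at *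
  generalize Real.exp (-(t * p)) = w at *
  linear_combination (p * (1 - p) * x + p ^ 2 * x * y + (1 - p) ^ 2 + p * (1 - p) * y) * e₃
    + p ^ 2 * e₄

lemma bernoulliMGF_mul_le {p₁ p₂ : ℝ} (hp : (p₁, p₂) ∈ C) (t : ℝ) :
    bernoulliMGF p₁ t * bernoulliMGF p₂ t ≤ Real.exp (coeff p₁ p₂ * t ^ 2) := by
  obtain ⟨h₁, h₂, hlt, hgt, heq⟩ := hp
  simp only at h₁ h₂ hlt hgt heq
  rcases lt_trichotomy (p₁ + p₂) 1 with h | h | h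
  · rw [coeff, if_neg h.ne]
    exact bernoulliMGF_mul_le_of_add_lt_one h₁ h₂ h (hlt h) t
  · rw [coeff, if_pos h]
    obtain rfl : p₂ = 1 - p₁ := by linarith
    rw [bernoulliMGF_mul_bernoulliMGF_one_sub]
    -- With `p₂ = 1 - p₁` the condition in `C` reads `6 p₁ (1 - p₁) ≥ 1`.
    exact one_add_mul_cosh_sub_one_le_exp (by nlinarith [heq h]) t
  · have h₁' : 1 - p₁ ∈ Set.Icc (0 : ℝ) 1 := ⟨by linarith [h₁.2], by linarith [h₁.1]⟩
    have h₂' : 1 - p₂ ∈ Set.Icc (0 : ℝ) 1 := ⟨by linarith [h₂.2], by linarith [h₂.1]⟩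
    have key := bernoulliMGF_mul_le_of_add_lt_one h₁' h₂' (by linarith)
      (fun s hs hs' => by
        rw [tStar_one_sub h₁ h₂ h] at hs'
        rw [deriv_gTwo_one_sub, neg_pos]
        refine hgt h (-s) (by linarith) ?_
        rw [EReal.coe_neg]
        exact EReal.lt_neg_comm.1 hs') (-t)
    rw [bernoulliMGF_one_sub, bernoulliMGF_one_sub, neg_neg, neg_sq] at key
    have hc : coeff p₁ p₂ = (1 - (1 - p₁) - (1 - p₂)) /
        Real.log ((1 - (1 - p₁)) / (1 - p₁) * ((1 - (1 - p₂)) / (1 - p₂))) := by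
      rw [coeff, if_neg h.ne', sub_sub_cancel 1 p₁, sub_sub_cancel 1 p₂,
        show p₁ / (1 - p₁) * (p₂ / (1 - p₂)) = ((1 - p₁) / p₁ * ((1 - p₂) / p₂))⁻¹ by
          rw [mul_inv, inv_div, inv_div], Real.log_inv, div_neg, ← neg_div]
      congr 1
      ring
    rwa [hc]

end KearnsSaul

theorem corollary4 (p₁ p₂ : ℝ) (hp : (p₁, p₂) ∈ KearnsSaul.C)
    {Ω : Type*} [MeasurableSpace Ω] (P : Measure Ω) [IsProbabilityMeasure P] (X : Ω → ℝ)
    (hX : HasLaw X (KearnsSaul.poiBin ![p₁, p₂]) P) (t : ℝ) :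
    Integrable (fun ω => Real.exp (t * X ω)) P ∧
      ∫ ω, Real.exp (t * X ω) ∂P ≤ Real.exp (KearnsSaul.coeff p₁ p₂ * t ^ 2) := by
  have hp' : ∀ i, ![p₁, p₂] i ∈ Set.Icc (0 : ℝ) 1 :=
    Fin.forall_fin_two.2 ⟨hp.1, hp.2.1⟩
  have hmap := hX.map_eq
  have hmeas : AEStronglyMeasurable (fun x => Real.exp (t * x)) (P.map X) := by fun_prop
  refine ⟨(integrable_map_measure hmeas hX.aemeasurable).1
    (hmap ▸ KearnsSaul.integrable_exp_poiBin hp' t), ?_⟩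
  rw [← integral_map (f := fun x => Real.exp (t * x)) hX.aemeasurable hmeas, hmap,
    KearnsSaul.integral_exp_poiBin hp', Fin.prod_univ_two]
  exact KearnsSaul.bernoulliMGF_mul_le hp t
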